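/- For $x,\omega\in\mathbb{R}$ put $\phi(t)=2^{1/4}e^{-\pi t^2}$ and $\phi_{x,\omega}(t)=\phi(t-x)e^{2\pi i t\omega}$, and for $f\in L^2(\mathbb{R})$ let $$V_\phi f(x,\omega)=\int_{\mathbb{R}} f(t)\,\overline{\phi_{x,\omega}(t)}\,dt .$$ For a set $Q\subset\mathbb{R}^2$ of finite measure let $L_Q$ be the operator on $L^2(\mathbb{R})$ given by $$L_Q f=\int_Q V_\phi f(x,\omega)\,\phi_{x,\omega}\,dx\,d\omega ;$$ it is compact, self-adjoint and non-negative. For $c>0$ let $\mu_1(c)\ge\mu_2(c)\ge\dots\ge 0$ be the eigenvalues of $L_Q$, repeated according to multiplicity, where $Q$ is a square of area $c$ with sides parallel to the coordinate axes (they do not depend on the centre of $Q$). **Theorem 1.8.** There exist numbers $c_0,\kappa>0$ such that for all real $c>c_0$ and all integers $n\ge 1$ with $n<c-\sqrt{c\log c}$ we have $$\mu_n(c)<1-\exp\bigl(-\kappa(\sqrt{c}-\sqrt{n})^2\bigr).$$ -/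

import Mathlib

open MeasureTheory

/-- The complex Hilbert space `L²(ℝ)`. -/
abbrev L2R : Type := Lp ℂ 2 (volume : Measure ℝ)

/-- The `L²`-normalised Gaussian window `φ(t) = 2^{1/4} exp(-π t²)`. -/
noncomputable def gaussWindow (t : ℝ) : ℝ := (2 : ℝ) ^ (1 / 4 : ℝ) * Real.exp (-Real.pi * t ^ 2)

/-- The time-frequency shift `φ_{x,ω}(t) = φ(t - x) exp(2πi t ω)`, with `p = (x, ω)`. -/
noncomputable def gaussShift (p : ℝ × ℝ) (t : ℝ) : ℂ :=
  (gaussWindow (t - p.1) : ℂ) * Complex.exp (2 * Real.pi * Complex.I * t * p.2)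

theorem continuous_gaussShift_uncurry : Continuous (fun q : (ℝ × ℝ) × ℝ => gaussShift q.1 q.2) := by
  unfold gaussShift gaussWindow
  fun_prop

theorem continuous_gaussShift (p : ℝ × ℝ) : Continuous (gaussShift p) :=
  continuous_gaussShift_uncurry.comp (by fun_prop : Continuous fun t : ℝ => (p, t))

theorem continuous_gaussShift_left (t : ℝ) : Continuous fun p => gaussShift p t :=
  continuous_gaussShift_uncurry.comp (by fun_prop : Continuous fun p : ℝ × ℝ => (p, t))

theorem gaussWindow_nonneg (t : ℝ) : 0 ≤ gaussWindow t := by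
  unfold gaussWindow; positivity

theorem norm_gaussShift (p : ℝ × ℝ) (t : ℝ) : ‖gaussShift p t‖ = gaussWindow (t - p.1) := by
  unfold gaussShift
  have h : (2 * Real.pi * Complex.I * t * p.2 : ℂ)
      = ((2 * Real.pi * t * p.2 : ℝ) : ℂ) * Complex.I := by push_cast; ring
  rw [norm_mul, h, Complex.norm_exp_ofReal_mul_I, mul_one, Complex.norm_real,
    Real.norm_of_nonneg (gaussWindow_nonneg _)]

theorem gaussWindow_le (t : ℝ) : gaussWindow t ≤ (2 : ℝ) ^ (1 / 4 : ℝ) := by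
  unfold gaussWindow
  refine mul_le_of_le_one_right (by positivity) (Real.exp_le_one_iff.mpr ?_)
  have := mul_nonneg Real.pi_pos.le (sq_nonneg t)
  linarith

theorem integrable_gaussWindow : Integrable gaussWindow :=
  (integrable_exp_neg_mul_sq Real.pi_pos).const_mul _

theorem gaussWindow_sq (t : ℝ) :
    gaussWindow t ^ 2 = Real.sqrt 2 * Real.exp (-(2 * Real.pi) * t ^ 2) := by
  unfold gaussWindow
  rw [mul_pow, ← Real.exp_nat_mul, ← Real.rpow_natCast, ← Real.rpow_mul (by norm_num),
    Real.sqrt_eq_rpow]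
  norm_num
  ring_nf

theorem integrable_gaussWindow_sq : Integrable (fun t => gaussWindow t ^ 2) := by
  simp_rw [gaussWindow_sq]
  exact (integrable_exp_neg_mul_sq (by positivity)).const_mul _

theorem integral_gaussWindow_sq : ∫ t, gaussWindow t ^ 2 = 1 := by
  simp_rw [gaussWindow_sq]
  rw [integral_const_mul, integral_gaussian, ← Real.sqrt_mul (by norm_num)]
  have : 2 * (Real.pi / (2 * Real.pi)) = 1 := by field_simp
  rw [this, Real.sqrt_one]

theorem memLp_gaussShift (p : ℝ × ℝ) : MemLp (gaussShift p) 2 volume := by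
  rw [memLp_two_iff_integrable_sq_norm (continuous_gaussShift p).aestronglyMeasurable]
  simp_rw [norm_gaussShift]
  exact integrable_gaussWindow_sq.comp_sub_right p.1

/-- The time-frequency shift `φ_{x,ω}` as an element of `L²(ℝ)`. -/
noncomputable def coherentState (p : ℝ × ℝ) : L2R := (memLp_gaussShift p).toLp (gaussShift p)

/-- The coherent state transform `V_φ f(x, ω) = ∫ f(t) conj(φ_{x,ω}(t)) dt`. -/
noncomputable def coherentTransform (f : L2R) (p : ℝ × ℝ) : ℂ :=
  ∫ t : ℝ, f t * (starRingEnd ℂ) (gaussShift p t)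

theorem coherentTransform_eq_inner (f : L2R) (p : ℝ × ℝ) :
    coherentTransform f p = inner ℂ (coherentState p) f := by
  rw [L2.inner_def]
  refine integral_congr_ae ?_
  filter_upwards [(memLp_gaussShift p).coeFn_toLp] with t ht
  rw [coherentState, ht, RCLike.inner_apply]

theorem norm_coherentState (p : ℝ × ℝ) : ‖coherentState p‖ = 1 := by
  have h1 : ‖coherentState p‖ ^ 2 = 1 := by
    have h2 : inner ℂ (coherentState p) (coherentState p) = (1 : ℂ) := by
      rw [← coherentTransform_eq_inner]
      have h3 : ∀ᵐ t, coherentState p t * (starRingEnd ℂ) (gaussShift p t)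
          = ((gaussWindow (t - p.1) ^ 2 : ℝ) : ℂ) := by
        filter_upwards [(memLp_gaussShift p).coeFn_toLp] with t ht
        rw [coherentState, ht, Complex.mul_conj, Complex.normSq_eq_norm_sq, norm_gaussShift]
      have h4 : ∫ t, gaussWindow (t - p.1) ^ 2 = 1 := by
        rw [integral_sub_right_eq_self (fun t => gaussWindow t ^ 2) p.1, integral_gaussWindow_sq]
      rw [coherentTransform, integral_congr_ae h3, integral_complex_ofReal, h4,
        Complex.ofReal_one]
    have h5 := inner_self_eq_norm_sq (𝕜 := ℂ) (coherentState p)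
    rw [h2] at h5
    simpa using h5.symm
  nlinarith [norm_nonneg (coherentState p)]

theorem continuous_inner_coherentState (q : ℝ × ℝ) :
    Continuous fun p => inner ℂ (coherentState p) (coherentState q) := by
  simp_rw [← coherentTransform_eq_inner]
  have h3 : ∀ p, coherentTransform (coherentState q) p
      = ∫ t, gaussShift q t * (starRingEnd ℂ) (gaussShift p t) := by
    intro p
    refine integral_congr_ae ?_
    filter_upwards [(memLp_gaussShift q).coeFn_toLp] with t ht
    rw [coherentState, ht]
  simp_rw [h3]
  refine continuous_of_dominated
    (F := fun p t => gaussShift q t * (starRingEnd ℂ) (gaussShift p t))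
    (bound := fun t => gaussWindow (t - q.1) * (2 : ℝ) ^ (1 / 4 : ℝ)) ?_ ?_ ?_ ?_
  · intro p
    exact ((continuous_gaussShift q).mul
      (Complex.continuous_conj.comp (continuous_gaussShift p))).aestronglyMeasurable
  · intro p
    refine Filter.Eventually.of_forall fun t => ?_
    rw [norm_mul, RCLike.norm_conj, norm_gaussShift, norm_gaussShift]
    exact mul_le_mul_of_nonneg_left (gaussWindow_le _) (gaussWindow_nonneg _)
  · exact (integrable_gaussWindow.comp_sub_right q.1).mul_const _
  · refine Filter.Eventually.of_forall fun t => ?_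
    exact continuous_const.mul (Complex.continuous_conj.comp (continuous_gaussShift_left t))

theorem continuous_coherentState : Continuous coherentState := by
  rw [continuous_iff_continuousAt]
  intro q
  rw [ContinuousAt, tendsto_iff_norm_sub_tendsto_zero]
  have h1 : ∀ p, ‖coherentState p - coherentState q‖
      = Real.sqrt (2 - 2 * (inner ℂ (coherentState p) (coherentState q)).re) := by
    intro p
    rw [← Real.sqrt_sq (norm_nonneg (coherentState p - coherentState q)), norm_sub_sq (𝕜 := ℂ),
      norm_coherentState, norm_coherentState]
    congr 1
    simp only [RCLike.re_to_complex]
    ring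
  simp_rw [h1]
  have h2 : Continuous fun p =>
      Real.sqrt (2 - 2 * (inner ℂ (coherentState p) (coherentState q)).re) :=
    Real.continuous_sqrt.comp (continuous_const.sub
      (continuous_const.mul (Complex.continuous_re.comp (continuous_inner_coherentState q))))
  have h3 := h2.tendsto q
  have h4 := inner_self_eq_norm_sq (𝕜 := ℂ) (coherentState q)
  rw [norm_coherentState, RCLike.re_to_complex] at h4
  rw [h4] at h3
  simpa using h3

theorem norm_coherentTransform_smul_le (f : L2R) (p : ℝ × ℝ) :
    ‖coherentTransform f p • coherentState p‖ ≤ ‖f‖ := by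
  rw [norm_smul, norm_coherentState, mul_one, coherentTransform_eq_inner]
  simpa [norm_coherentState] using norm_inner_le_norm (𝕜 := ℂ) (coherentState p) f

theorem integrableOn_coherent (Q : Set (ℝ × ℝ)) (hQ : volume Q < ⊤) (f : L2R) :
    IntegrableOn (fun p => coherentTransform f p • coherentState p) Q := by
  refine IntegrableOn.of_bound hQ ?_ ‖f‖
    (Filter.Eventually.of_forall fun p => norm_coherentTransform_smul_le f p)
  simp_rw [coherentTransform_eq_inner]
  have hc : Continuous fun p => inner ℂ (coherentState p) f :=
    continuous_coherentState.inner continuous_const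
  exact (hc.smul continuous_coherentState).aestronglyMeasurable

/-- The localization operator `L_Q f = ∫_Q V_φ f(x, ω) φ_{x,ω} dx dω` on `L²(ℝ)`, for a set `Q` of
finite measure in the time-frequency plane (a Bochner integral in `L²(ℝ)`). -/
noncomputable def localizationOp (Q : Set (ℝ × ℝ)) (hQ : volume Q < ⊤) : L2R →L[ℂ] L2R :=
  LinearMap.mkContinuous
    { toFun := fun f => ∫ p in Q, coherentTransform f p • coherentState p
      map_add' := fun f g => by
        rw [← integral_add (integrableOn_coherent Q hQ f) (integrableOn_coherent Q hQ g)]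
        simp_rw [coherentTransform_eq_inner, inner_add_right, add_smul]
      map_smul' := fun a f => by
        rw [RingHom.id_apply, ← integral_smul]
        simp_rw [coherentTransform_eq_inner, inner_smul_right, mul_smul] }
    (volume.real Q)
    (fun f => by
      rw [mul_comm]
      exact norm_setIntegral_le_of_norm_le_const hQ
        fun p _ => norm_coherentTransform_smul_le f p)

/-- For a compact self-adjoint non-negative operator `T`, the `n`-th term (`n ≥ 1`) of the sequence
`μ₁ ≥ μ₂ ≥ … ≥ 0` of eigenvalues of `T` repeated according to multiplicity: the largest `t > 0` such
that at least `n` eigenvalues, counted with multiplicity, are `≥ t` (that is, there are `n`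
orthonormal eigenvectors with eigenvalues `≥ t`), and `0` if there is no such `t`. -/
noncomputable def nthEigenvalue {H : Type*} [NormedAddCommGroup H] [InnerProductSpace ℂ H]
    (T : H →L[ℂ] H) (n : ℕ) : ℝ :=
  sSup {t : ℝ | 0 < t ∧ ∃ v : Fin n → H, Orthonormal ℂ v ∧
    ∀ i, ∃ s : ℝ, t ≤ s ∧ T (v i) = (s : ℂ) • v i}

/-- The closed square of area `c` with centre `a` and sides parallel to the axes. -/
def square (a : ℝ × ℝ) (c : ℝ) : Set (ℝ × ℝ) :=
  Set.Icc (a.1 - Real.sqrt c / 2) (a.1 + Real.sqrt c / 2) ×ˢ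
    Set.Icc (a.2 - Real.sqrt c / 2) (a.2 + Real.sqrt c / 2)

theorem volume_square_lt_top (a : ℝ × ℝ) (c : ℝ) : volume (square a c) < ⊤ :=
  (isCompact_Icc.prod isCompact_Icc).measure_lt_top

/-- `μ_n` of the square of area `c` centred at `a`: the `n`-th eigenvalue of `L_Q`, `Q` that
square. (It does not depend on `a`.) -/
noncomputable def coherentEigenvalue (a : ℝ × ℝ) (c : ℝ) (n : ℕ) : ℝ :=
  nthEigenvalue (localizationOp (square a c) (volume_square_lt_top a c)) n

open scoped FourierTransform SchwartzMap ENNReal ContDiff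

/-! Put d = √c - √n and suppose μ_n ≥ 1 - exp(-400 d²). Then there are n orthonormal eigenfunctions
f_i with eigenvalues at least 1 - 2 exp(-400 d²). Since V_φ is an isometry into L²(ℝ²), each V_φ f_i
has mass at most 2 exp(-400 d²) outside Q.

Up to a Gaussian weight, |V_φ f_i| is the modulus of an entire function, so smallness outside Q
propagates inwards: |V_φ f_i|² ≤ exp(-16 d²) at every point outside the concentric square of side √c
- 2d (`coherentTransform_sq_le_of_notMem_innerSquare`). Inside that square Bessel's inequality gives
∑ |V_φ f_i|² ≤ 1. Integrating over Q bounds n, up to small errors, by the smaller area (√c - 2d)₊²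
(`card_mul_le_of_concentrated`).

But √c - 2d = √n - d, so that area is at most n - d² when d ≤ √n and is 0 otherwise. The hypothesis
on n gives log c ≤ 4d², so exp(-16 d²) beats c⁴ and the errors total at most 1/2: a contradiction.
-/

/-! ### Plancherel for integrals, and the isometry property of the coherent state transform. -/

theorem fourier_toLp_ae_eq {g : ℝ → ℂ} (h1 : Integrable g) (h2 : MemLp g 2) :
    ((𝓕 (h2.toLp g) : Lp ℂ 2 (volume : Measure ℝ)) : ℝ → ℂ) =ᵐ[volume] 𝓕 g := by
  have hcont : Continuous (𝓕 g) :=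
    VectorFourier.fourierIntegral_continuous Real.continuous_fourierChar
      (by fun_prop) h1
  refine ae_eq_of_integral_contDiff_smul_eq
    ((Lp.memLp _).locallyIntegrable (by norm_num)) hcont.locallyIntegrable ?_
  intro u hu hsupp
  have hs : HasCompactSupport (fun x => (u x : ℂ)) := hsupp.comp_left Complex.ofReal_zero
  let U : 𝓢(ℝ, ℂ) := hs.toSchwartzMap (Complex.ofRealCLM.contDiff.comp hu)
  have hU : ∀ x, U x = (u x : ℂ) := fun x => rfl
  -- Tested against `U`, the L² transform is given by duality of tempered distributions and the
  -- integral transform by Fubini; both move 𝓕 onto `U`.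
  have key := congrArg (fun T => T U) (Lp.fourier_toTemperedDistribution_eq (h2.toLp g))
  simp only [TemperedDistribution.fourier_apply, Lp.toTemperedDistribution_apply] at key
  have e1 : ∫ x, u x • (𝓕 (h2.toLp g) : Lp ℂ 2 (volume : Measure ℝ)) x
      = ∫ x, U x • (𝓕 (h2.toLp g) : Lp ℂ 2 (volume : Measure ℝ)) x := by
    simp [hU]
  rw [e1, ← key]
  have e2 : ∫ x, (𝓕 U) x • (h2.toLp g) x = ∫ x, (𝓕 U) x • g x := by
    refine integral_congr_ae ?_
    filter_upwards [h2.coeFn_toLp] with x hx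
    rw [hx]
  rw [e2]
  have e3 := VectorFourier.integral_fourierIntegral_smul_eq_flip (L := innerₗ ℝ) (μ := volume)
    (ν := volume) (f := U) (g := g) Real.continuous_fourierChar continuous_inner U.integrable h1
  have e4 : (innerₗ ℝ).flip = innerₗ ℝ := by ext; simp
  rw [e4] at e3
  have e5 : (𝓕 U : 𝓢(ℝ, ℂ)) = (𝓕 (U : ℝ → ℂ) : ℝ → ℂ) := SchwartzMap.fourier_coe U
  rw [e5]
  refine Eq.trans e3 ?_
  refine integral_congr_ae (Filter.Eventually.of_forall fun x => ?_)
  rfl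

theorem eLpNorm_two_sq {α : Type*} [MeasurableSpace α] {μ : Measure α} (f : α → ℂ) :
    eLpNorm f 2 μ ^ 2 = ∫⁻ x, ‖f x‖ₑ ^ 2 ∂μ := by
  have := eLpNorm_nnreal_pow_eq_lintegral (μ := μ) (f := f) (p := 2) (by norm_num)
  simpa using this

theorem lintegral_enorm_fourier_sq {g : ℝ → ℂ} (h1 : Integrable g) (h2 : MemLp g 2) :
    ∫⁻ x, ‖𝓕 g x‖ₑ ^ 2 = ∫⁻ x, ‖g x‖ₑ ^ 2 := by
  rw [← eLpNorm_two_sq, ← eLpNorm_two_sq, ← eLpNorm_congr_ae (fourier_toLp_ae_eq h1 h2),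
    ← eLpNorm_congr_ae h2.coeFn_toLp]
  have h := Lp.norm_fourier_eq (h2.toLp g)
  rw [Lp.norm_def, Lp.norm_def,
    ENNReal.toReal_eq_toReal_iff' (Lp.eLpNorm_ne_top _) (Lp.eLpNorm_ne_top _)] at h
  rw [h]

theorem continuous_coherentTransform (f : L2R) : Continuous (coherentTransform f) := by
  have : coherentTransform f = fun p => inner ℂ (coherentState p) f :=
    funext (coherentTransform_eq_inner f)
  rw [this]
  exact continuous_coherentState.inner continuous_const

theorem continuous_gaussWindow : Continuous gaussWindow := by
  unfold gaussWindow; fun_prop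

theorem memLp_gaussWindow_sub (x : ℝ) : MemLp (fun t => (gaussWindow (t - x) : ℂ)) 2 volume := by
  refine (memLp_gaussShift (x, 0)).congr_norm ?_ ?_
  · exact (Complex.continuous_ofReal.comp
      (continuous_gaussWindow.comp (continuous_sub_right x))).aestronglyMeasurable
  · refine Filter.Eventually.of_forall fun t => ?_
    rw [norm_gaussShift, Complex.norm_real, Real.norm_of_nonneg (gaussWindow_nonneg _)]

theorem coherentTransform_eq_fourier (f : L2R) (x y : ℝ) :
    coherentTransform f (x, y) = 𝓕 (fun t => f t * (gaussWindow (t - x) : ℂ)) y := by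
  rw [Real.fourier_real_eq_integral_exp_smul, coherentTransform]
  refine integral_congr_ae (Filter.Eventually.of_forall fun t => ?_)
  simp only [gaussShift, map_mul, Complex.conj_ofReal, smul_eq_mul, ← Complex.exp_conj,
    Complex.conj_I, map_ofNat]
  rw [mul_comm (Complex.exp _), ← mul_assoc]
  congr 2
  push_cast
  ring

theorem lintegral_enorm_coherentTransform_fiber (f : L2R) (x : ℝ) :
    ∫⁻ y, ‖coherentTransform f (x, y)‖ₑ ^ 2
      = ∫⁻ t, ‖f t‖ₑ ^ 2 * ENNReal.ofReal (gaussWindow (t - x) ^ 2) := by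
  simp_rw [coherentTransform_eq_fourier]
  have h1 : Integrable (fun t => f t * (gaussWindow (t - x) : ℂ)) :=
    (Lp.memLp f).integrable_mul (memLp_gaussWindow_sub x)
  have h2 : MemLp (fun t => f t * (gaussWindow (t - x) : ℂ)) 2 volume := by
    refine MemLp.of_le_mul (c := (2 : ℝ) ^ (1 / 4 : ℝ)) (Lp.memLp f) h1.1 ?_
    refine Filter.Eventually.of_forall fun t => ?_
    rw [norm_mul, Complex.norm_real, Real.norm_of_nonneg (gaussWindow_nonneg _), mul_comm]
    exact mul_le_mul_of_nonneg_right (gaussWindow_le _) (norm_nonneg _)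
  rw [lintegral_enorm_fourier_sq h1 h2]
  refine lintegral_congr fun t => ?_
  rw [enorm_mul, mul_pow, ← ofReal_norm (gaussWindow (t - x) : ℂ), Complex.norm_real,
    Real.norm_of_nonneg (gaussWindow_nonneg _), ENNReal.ofReal_pow (gaussWindow_nonneg _)]

/-- For fixed x the transform is the Fourier transform of f · φ(· - x). Plancherel in ω, then
Tonelli and ‖φ‖ = 1, give the isometry. -/
theorem lintegral_enorm_coherentTransform (f : L2R) :
    ∫⁻ p, ‖coherentTransform f p‖ₑ ^ 2 = ‖f‖ₑ ^ 2 := by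
  have hm : Measurable fun p : ℝ × ℝ => ‖coherentTransform f p‖ₑ ^ 2 :=
    (continuous_coherentTransform f).measurable.enorm.pow_const 2
  have hg : Measurable fun q : ℝ × ℝ => ENNReal.ofReal (gaussWindow (q.2 - q.1) ^ 2) := by
    refine ENNReal.measurable_ofReal.comp (Continuous.measurable ?_)
    exact (continuous_gaussWindow.comp (by fun_prop)).pow 2
  rw [Measure.volume_eq_prod, lintegral_prod _ hm.aemeasurable]
  simp_rw [lintegral_enorm_coherentTransform_fiber]
  rw [lintegral_lintegral_swap]
  · have h : ∀ t : ℝ, ∫⁻ x, ENNReal.ofReal (gaussWindow (t - x) ^ 2) = 1 := by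
      intro t
      rw [← ofReal_integral_eq_lintegral_ofReal
        (integrable_gaussWindow_sq.comp_sub_left t)
        (Filter.Eventually.of_forall fun x => sq_nonneg _),
        integral_sub_left_eq_self (fun s => gaussWindow s ^ 2), integral_gaussWindow_sq,
        ENNReal.ofReal_one]
    have h3 : ∀ t : ℝ, ∫⁻ x, ‖f t‖ₑ ^ 2 * ENNReal.ofReal (gaussWindow (t - x) ^ 2)
        = ‖f t‖ₑ ^ 2 := by
      intro t
      rw [lintegral_const_mul' _ _ (by simp), h, mul_one]
    simp_rw [h3]
    rw [← eLpNorm_two_sq, Lp.enorm_def]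
  · refine AEMeasurable.mul ?_ hg.aemeasurable
    exact ((Lp.aestronglyMeasurable f).enorm.pow_const 2).comp_quasiMeasurePreserving
      Measure.quasiMeasurePreserving_snd

theorem integrable_coherentTransform_sq (f : L2R) :
    Integrable fun p => ‖coherentTransform f p‖ ^ 2 := by
  refine ⟨((continuous_coherentTransform f).norm.pow 2).aestronglyMeasurable, ?_⟩
  simp only [HasFiniteIntegral, enorm_pow, enorm_norm]
  rw [lintegral_enorm_coherentTransform]
  simp

theorem integral_coherentTransform_sq (f : L2R) :
    ∫ p, ‖coherentTransform f p‖ ^ 2 = ‖f‖ ^ 2 := by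
  rw [integral_eq_lintegral_of_nonneg_ae (Filter.Eventually.of_forall fun x => sq_nonneg _)
    ((continuous_coherentTransform f).norm.pow 2).aestronglyMeasurable]
  have : ∀ p, ENNReal.ofReal (‖coherentTransform f p‖ ^ 2) = ‖coherentTransform f p‖ₑ ^ 2 := by
    intro p
    rw [ENNReal.ofReal_pow (norm_nonneg _), ofReal_norm]
  simp_rw [this]
  rw [lintegral_enorm_coherentTransform]
  simp

/-! ### The quadratic form of the localization operator. -/

theorem localizationOp_apply (Q : Set (ℝ × ℝ)) (hQ : volume Q < ⊤) (f : L2R) :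
    localizationOp Q hQ f = ∫ p in Q, coherentTransform f p • coherentState p := rfl

theorem inner_localizationOp_self (Q : Set (ℝ × ℝ)) (hQ : volume Q < ⊤) (f : L2R) :
    inner ℂ f (localizationOp Q hQ f) = ((∫ p in Q, ‖coherentTransform f p‖ ^ 2 : ℝ) : ℂ) := by
  rw [localizationOp_apply, ← integral_inner (integrableOn_coherent Q hQ f),
    ← integral_complex_ofReal]
  refine integral_congr_ae (Filter.Eventually.of_forall fun p => ?_)
  simp only [inner_smul_right]
  rw [coherentTransform_eq_inner, ← inner_conj_symm f, Complex.mul_conj,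
    Complex.normSq_eq_norm_sq]

theorem setIntegral_coherentTransform_sq_of_eigenvector {Q : Set (ℝ × ℝ)} {hQ : volume Q < ⊤}
    {f : L2R} (hf : ‖f‖ = 1) {s : ℝ} (h : localizationOp Q hQ f = (s : ℂ) • f) :
    ∫ p in Q, ‖coherentTransform f p‖ ^ 2 = s := by
  have h1 := inner_localizationOp_self Q hQ f
  rw [h, inner_smul_right, inner_self_eq_norm_sq_to_K, hf] at h1
  have h2 : (s : ℂ) = ((∫ p in Q, ‖coherentTransform f p‖ ^ 2 : ℝ) : ℂ) := by simpa using h1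
  exact (Complex.ofReal_injective h2).symm

theorem norm_coherentTransform_le (f : L2R) (p : ℝ × ℝ) : ‖coherentTransform f p‖ ≤ ‖f‖ := by
  simpa [norm_smul, norm_coherentState] using norm_coherentTransform_smul_le f p

/-- Bessel's inequality for the unit vector φ_{x,ω}; the only place where mutual orthogonality
enters. -/
theorem sum_coherentTransform_sq_le {n : ℕ} {v : Fin n → L2R} (hv : Orthonormal ℂ v)
    (p : ℝ × ℝ) : ∑ i, ‖coherentTransform (v i) p‖ ^ 2 ≤ 1 := by
  have h := hv.sum_inner_products_le (coherentState p) (s := Finset.univ)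
  rw [norm_coherentState] at h
  simp_rw [coherentTransform_eq_inner, norm_inner_symm (coherentState p)]
  simpa using h

/-! ### Analyticity of the transform. -/

/-- The unweighted Bargmann-type transform
`w ↦ ∫ f(t) 2^{1/4} exp(-π t² + 2π t w) dt`, an entire function of `w`. -/
noncomputable def bargmannIntegral (f : L2R) (w : ℂ) : ℂ :=
  ∫ t : ℝ, f t * (((2 : ℝ) ^ (1 / 4 : ℝ) : ℝ) * Complex.exp (-Real.pi * t ^ 2 + 2 * Real.pi * t * w))

theorem integrable_norm_mul_exp_neg_sq (f : L2R) :
    Integrable fun t : ℝ => ‖f t‖ * Real.exp (-(Real.pi / 2) * t ^ 2) := by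
  suffices hg : MemLp (fun t : ℝ => Real.exp (-(Real.pi / 2) * t ^ 2)) 2 volume by
    exact (Lp.memLp f).norm.integrable_mul hg
  rw [memLp_two_iff_integrable_sq (by fun_prop)]
  have : ∀ t : ℝ, Real.exp (-(Real.pi / 2) * t ^ 2) ^ 2 = Real.exp (-Real.pi * t ^ 2) := by
    intro t
    rw [← Real.exp_nat_mul]
    congr 1
    push_cast
    ring
  simp_rw [this]
  exact integrable_exp_neg_mul_sq Real.pi_pos

/-- The factor exp(2π|t|) dominates both 1 and |2πt|, so one majorant serves the integrand and its
derivative in w. It is absorbed by |t| N ≤ N² + t²/4. -/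
theorem norm_exp_bargmann_le {N t : ℝ} {w : ℂ} (hw : ‖w‖ + 1 ≤ N) :
    Real.exp (2 * Real.pi * |t|) * ‖Complex.exp (-Real.pi * t ^ 2 + 2 * Real.pi * t * w)‖
      ≤ Real.exp (2 * Real.pi * N ^ 2) * Real.exp (-(Real.pi / 2) * t ^ 2) := by
  have hre : (-Real.pi * t ^ 2 + 2 * Real.pi * t * w : ℂ).re
      = -Real.pi * t ^ 2 + 2 * Real.pi * (t * w.re) := by
    have : (-Real.pi * t ^ 2 + 2 * Real.pi * t * w : ℂ)
        = ((-Real.pi * t ^ 2 : ℝ) : ℂ) + ((2 * Real.pi * t : ℝ) : ℂ) * w := by push_cast; ring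
    rw [this, Complex.add_re, Complex.ofReal_re, Complex.re_ofReal_mul]
    ring
  rw [Complex.norm_exp, hre, ← Real.exp_add, ← Real.exp_add, Real.exp_le_exp]
  have h1 : t * w.re ≤ |t| * ‖w‖ :=
    (le_abs_self _).trans (by
      rw [abs_mul]
      exact mul_le_mul_of_nonneg_left (Complex.abs_re_le_norm w) (abs_nonneg t))
  have h2 : |t| * ‖w‖ ≤ |t| * (N - 1) :=
    mul_le_mul_of_nonneg_left (by linarith) (abs_nonneg t)
  have h3 : |t| + t * w.re ≤ |t| * N := by linarith
  have h4 : |t| + t * w.re ≤ N ^ 2 + t ^ 2 / 4 := by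
    nlinarith [sq_nonneg (|t| - 2 * N), sq_abs t]
  nlinarith [mul_le_mul_of_nonneg_left h4 Real.pi_pos.le]

theorem differentiable_bargmannIntegral (f : L2R) : Differentiable ℂ (bargmannIntegral f) := by
  intro w₀
  set k : ℝ := (2 : ℝ) ^ (1 / 4 : ℝ) with hk
  have hk0 : 0 ≤ k := by positivity
  have hmeas : ∀ g : ℝ → ℂ, Continuous g → AEStronglyMeasurable (fun t => f t * g t) volume :=
    fun g hg => (Lp.aestronglyMeasurable f).mul hg.aestronglyMeasurable
  set N : ℝ := ‖w₀‖ + 2 with hN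
  have hint := ((integrable_norm_mul_exp_neg_sq f).const_mul (k * Real.exp (2 * Real.pi * N ^ 2)))
  have hbound : ∀ (t : ℝ) (w : ℂ) (b : ℂ), ‖w‖ + 1 ≤ N → ‖b‖ ≤ Real.exp (2 * Real.pi * |t|) →
      ‖f t * (k * (b * Complex.exp (-Real.pi * t ^ 2 + 2 * Real.pi * t * w)))‖
        ≤ k * Real.exp (2 * Real.pi * N ^ 2)
          * (‖f t‖ * Real.exp (-(Real.pi / 2) * t ^ 2)) := by
    intro t w b hw hb
    rw [norm_mul, norm_mul, norm_mul, Complex.norm_real, Real.norm_of_nonneg hk0]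
    have h1 := (mul_le_mul_of_nonneg_right hb (norm_nonneg _)).trans
      (norm_exp_bargmann_le (t := t) hw)
    calc _ ≤ ‖f t‖ * (k * (Real.exp (2 * Real.pi * N ^ 2)
          * Real.exp (-(Real.pi / 2) * t ^ 2))) := by gcongr
      _ = _ := by ring
  refine (hasDerivAt_integral_of_dominated_loc_of_deriv_le (𝕜 := ℂ) (μ := volume)
    (F := fun w (t : ℝ) => f t * (k * Complex.exp (-Real.pi * t ^ 2 + 2 * Real.pi * t * w)))
    (F' := fun w (t : ℝ) => f t * (k * ((2 * Real.pi * t)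
      * Complex.exp (-Real.pi * t ^ 2 + 2 * Real.pi * t * w))))
    (bound := fun t => k * Real.exp (2 * Real.pi * N ^ 2)
      * (‖f t‖ * Real.exp (-(Real.pi / 2) * t ^ 2)))
    (Metric.ball_mem_nhds w₀ one_pos) ?_ ?_ ?_ ?_ hint ?_).2.differentiableAt
  · exact Filter.Eventually.of_forall fun w => hmeas _ (by fun_prop)
  · refine Integrable.mono' hint (hmeas _ (by fun_prop))
      (Filter.Eventually.of_forall fun t => ?_)
    have := hbound t w₀ 1 (by linarith) (by
      rw [norm_one]; exact Real.one_le_exp (by positivity))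
    rwa [one_mul] at this
  · exact hmeas _ (by fun_prop)
  · refine Filter.Eventually.of_forall fun t w hw => hbound t w _ ?_ ?_
    · have h1 : ‖w - w₀‖ < 1 := by rwa [Metric.mem_ball, dist_eq_norm] at hw
      have h2 : ‖w‖ ≤ ‖w - w₀‖ + ‖w₀‖ := norm_le_norm_sub_add w w₀
      linarith
    · rw [norm_mul, norm_mul, Complex.norm_real, Complex.norm_real, Complex.norm_ofNat,
        Real.norm_of_nonneg Real.pi_pos.le, Real.norm_eq_abs]
      linarith [Real.add_one_le_exp (2 * Real.pi * |t|)]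
  · refine Filter.Eventually.of_forall fun t w _ => ?_
    have h1 : HasDerivAt (fun w : ℂ => (-Real.pi * t ^ 2 + 2 * Real.pi * t * w : ℂ))
        (2 * Real.pi * t) w := by
      simpa using ((hasDerivAt_id w).const_mul (2 * Real.pi * t : ℂ)).const_add
        (-Real.pi * t ^ 2 : ℂ)
    refine ((h1.cexp.const_mul (k : ℂ)).const_mul (f t)).congr_deriv ?_
    ring

theorem coherentTransform_eq_bargmannIntegral (f : L2R) (x y : ℝ) :
    coherentTransform f (x, y)
      = Real.exp (-Real.pi * x ^ 2) * bargmannIntegral f (x - y * Complex.I) := by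
  rw [coherentTransform, bargmannIntegral, ← integral_const_mul]
  refine integral_congr_ae (Filter.Eventually.of_forall fun t => ?_)
  simp only [gaussShift, gaussWindow, map_mul, Complex.conj_ofReal, ← Complex.exp_conj,
    Complex.conj_I, map_ofNat]
  push_cast
  have : Complex.exp (-Real.pi * (t - x) ^ 2) * Complex.exp (2 * Real.pi * -Complex.I * t * y)
      = Complex.exp (-Real.pi * x ^ 2)
        * Complex.exp (-Real.pi * t ^ 2 + 2 * Real.pi * t * (x - y * Complex.I)) := by
    rw [← Complex.exp_add, ← Complex.exp_add]
    congr 1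
    ring
  linear_combination (f t * ((2 : ℝ) ^ (1 / 4 : ℝ) : ℝ)) * this

/-- Around each point of the time-frequency plane, the coherent state transform is, up to a
Gaussian weight and in absolute value, an entire function. -/
theorem exists_entire_norm_eq (f : L2R) (z : ℝ × ℝ) :
    ∃ F : ℂ → ℂ, Differentiable ℂ F ∧ ∀ w : ℂ,
      ‖F w‖ = Real.exp (Real.pi / 2 * ‖w‖ ^ 2)
        * ‖coherentTransform f (z.1 + w.re, z.2 - w.im)‖ := by
  -- The exponential factor recentres the weight: its modulus turns exp(π(z.1 + Re w)²) into
  -- exp(π|w|²/2).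
  refine ⟨fun w => bargmannIntegral f (z.1 - z.2 * Complex.I + w)
    * Complex.exp (-Real.pi * (w ^ 2 / 2 + 2 * z.1 * w + z.1 ^ 2)), ?_, fun w => ?_⟩
  · exact ((differentiable_bargmannIntegral f).comp (by fun_prop)).mul (by fun_prop)
  · have hw : ((z.1 + w.re : ℝ) - (z.2 - w.im : ℝ) * Complex.I : ℂ)
        = z.1 - z.2 * Complex.I + w := by
      conv_rhs => rw [← Complex.re_add_im w]
      push_cast
      ring
    rw [coherentTransform_eq_bargmannIntegral, hw, norm_mul, norm_mul, Complex.norm_real,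
      Real.norm_of_nonneg (Real.exp_pos _).le, Complex.norm_exp, ← mul_assoc, ← Real.exp_add,
      mul_comm]
    congr 2
    rw [← Complex.normSq_eq_norm_sq, Complex.normSq_apply]
    simp [pow_two]
    ring

/-! ### Pointwise bounds from analyticity. -/

/-- By the Schwarz lemma the entire function attached to z is Lipschitz near 0, so a value ε at z
persists, up to a constant factor, on a neighbourhood of radius of order ε. Its contribution to the
integral is of order ε² · ε². -/
theorem norm_coherentTransform_pow_four_le {f : L2R} (hf : ‖f‖ ≤ 1) (z : ℝ × ℝ) :
    ‖coherentTransform f z‖ ^ 4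
      ≤ 64 * Real.exp (2 * Real.pi) * ∫ p in Metric.closedBall z 1, ‖coherentTransform f p‖ ^ 2 := by
  obtain ⟨F, hF, hFn⟩ := exists_entire_norm_eq f z
  set ε := ‖coherentTransform f z‖ with hε
  have hε1 : ε ≤ 1 := (norm_coherentTransform_le f z).trans hf
  rcases (norm_nonneg (coherentTransform f z)).eq_or_lt with h0 | h0
  · rw [← hε] at h0
    have : 0 ≤ ∫ p in Metric.closedBall z 1, ‖coherentTransform f p‖ ^ 2 :=
      integral_nonneg fun p => sq_nonneg _
    rw [← h0, zero_pow (by norm_num)]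
    exact mul_nonneg (mul_pos (by norm_num) (Real.exp_pos _)).le this
  set B := Real.exp (Real.pi / 2) with hB
  have hB1 : 1 ≤ B := Real.one_le_exp (by positivity)
  have hB4 : B ^ 4 = Real.exp (2 * Real.pi) := by
    rw [hB, ← Real.exp_nat_mul]
    congr 1
    push_cast
    ring
  have hexp : ∀ w : ℂ, ‖w‖ ≤ 1 → Real.exp (Real.pi / 2 * ‖w‖ ^ 2) ≤ B := by
    intro w hw
    rw [hB, Real.exp_le_exp]
    have := pow_le_one₀ (n := 2) (norm_nonneg w) hw
    nlinarith [Real.pi_pos]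
  have hFB : ∀ w : ℂ, ‖w‖ ≤ 1 → ‖F w‖ ≤ B := by
    intro w hw
    rw [hFn]
    have h1 := (norm_coherentTransform_le f (z.1 + w.re, z.2 - w.im)).trans hf
    calc _ ≤ B * 1 := mul_le_mul (hexp w hw) h1 (norm_nonneg _) (by positivity)
      _ = B := mul_one _
  have hF0 : ‖F 0‖ = ε := by rw [hFn]; simp [hε]
  have hlip : ∀ w : ℂ, ‖w‖ < 1 → ‖F w - F 0‖ ≤ 2 * B * ‖w‖ := by
    intro w hw
    have := Complex.dist_le_div_mul_dist_of_mapsTo_ball (f := F) (c := 0) (z := w) (R₁ := 1)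
      (R₂ := 2 * B) hF.differentiableOn ?_ (by simpa using hw)
    · simpa [dist_eq_norm] using this
    · intro x hx
      have hx1 : ‖x‖ ≤ 1 := by simpa using (Metric.mem_ball.mp hx).le
      rw [Metric.mem_closedBall, dist_eq_norm]
      have := norm_sub_le (F x) (F 0)
      have h2 := hFB x hx1
      have h3 := hFB 0 (by simp)
      linarith
  have hlow : ∀ w : ℂ, ‖w‖ ≤ ε / (4 * B) →
      ε / (2 * B) ≤ ‖coherentTransform f (z.1 + w.re, z.2 - w.im)‖ := by
    intro w hw
    have hw' : 4 * B * ‖w‖ ≤ ε := by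
      rw [le_div_iff₀ (by positivity)] at hw
      linarith
    have hw1 : ‖w‖ < 1 := by nlinarith [norm_nonneg w]
    have h1 := hlip w hw1
    have h2 := norm_sub_norm_le (F 0) (F w)
    rw [norm_sub_rev, hF0] at h2
    have h3 : ε / 2 ≤ ‖F w‖ := by linarith
    rw [hFn] at h3
    have h4 := mul_le_mul_of_nonneg_right (hexp w hw1.le)
      (norm_nonneg (coherentTransform f (z.1 + w.re, z.2 - w.im)))
    rw [div_le_iff₀ (by positivity)]
    linarith
  -- Balls in ℝ × ℝ are for the sup metric, hence squares; half of ε / (4B) suffices because |w| ≤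
  -- |Re w| + |Im w|.
  set r := ε / (8 * B) with hr
  have hr0 : 0 < r := by positivity
  have hr1 : r ≤ 1 := by
    rw [hr, div_le_one (by positivity)]
    linarith
  have hsub : Metric.closedBall z r ⊆ Metric.closedBall z 1 := Metric.closedBall_subset_closedBall hr1
  have hpt : ∀ p ∈ Metric.closedBall z r, (ε / (2 * B)) ^ 2 ≤ ‖coherentTransform f p‖ ^ 2 := by
    intro p hp
    have h1 := hlow ⟨p.1 - z.1, z.2 - p.2⟩ ?_
    · have h2 : ((z.1 + (p.1 - z.1), z.2 - (z.2 - p.2)) : ℝ × ℝ) = p := by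
        ext <;> simp
      simp only [h2] at h1
      exact pow_le_pow_left₀ (by positivity) h1 2
    · rw [Metric.mem_closedBall, Prod.dist_eq, max_le_iff, Real.dist_eq, Real.dist_eq] at hp
      refine (Complex.norm_le_abs_re_add_abs_im _).trans ?_
      simp only
      rw [abs_sub_comm z.2]
      have : ε / (4 * B) = r + r := by rw [hr]; field_simp; ring
      linarith [hp.1, hp.2]
  have hint := (integrable_coherentTransform_sq f).integrableOn (s := Metric.closedBall z 1)
  have hvol : volume.real (Metric.closedBall z r) = (2 * r) ^ 2 := by
    rw [← closedBall_prod_same, Measure.volume_eq_prod, Measure.real, Measure.prod_prod,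
      Real.volume_closedBall, Real.volume_closedBall, ENNReal.toReal_mul,
      ENNReal.toReal_ofReal (by positivity)]
    ring
  have h5 : (2 * r) ^ 2 * (ε / (2 * B)) ^ 2
      ≤ ∫ p in Metric.closedBall z 1, ‖coherentTransform f p‖ ^ 2 := by
    calc _ = ∫ _ in Metric.closedBall z r, (ε / (2 * B)) ^ 2 := by
          rw [setIntegral_const, hvol, smul_eq_mul]
      _ ≤ ∫ p in Metric.closedBall z r, ‖coherentTransform f p‖ ^ 2 :=
          setIntegral_mono_on (integrableOn_const Metric.isBounded_closedBall.measure_lt_top.ne)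
            (hint.mono_set hsub) Metric.isClosed_closedBall.measurableSet hpt
      _ ≤ _ := setIntegral_mono_set hint
          (Filter.Eventually.of_forall fun p => sq_nonneg _) hsub.eventuallyLE
  rw [← hB4]
  have h6 : ε ^ 4 = 64 * B ^ 4 * ((2 * r) ^ 2 * (ε / (2 * B)) ^ 2) := by
    rw [hr]; field_simp; norm_num
  rw [h6]
  exact mul_le_mul_of_nonneg_left h5 (by positivity)

/-- A quarter of the circle of radius `R` about `z` on which the coherent state transform is at
most `m` controls its value at `z`. -/
theorem norm_coherentTransform_pow_four_le_of_arc {f : L2R} (hf : ‖f‖ ≤ 1) (z : ℝ × ℝ) {R m : ℝ}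
    (hR : 0 < R) {u : ℂ} (hu : ‖u‖ = 1)
    (h : ∀ w : ℂ, ‖w‖ = R → 2 / 3 * R ≤ (u * w).re →
      ‖coherentTransform f (z.1 + w.re, z.2 - w.im)‖ ≤ m) :
    ‖coherentTransform f z‖ ^ 4 ≤ Real.exp (2 * Real.pi * R ^ 2) * m := by
  obtain ⟨F, hF, hFn⟩ := exists_entire_norm_eq f z
  have hF0 : ‖F 0‖ = ‖coherentTransform f z‖ := by rw [hFn]; simp
  set E := Real.exp (Real.pi / 2 * R ^ 2) with hE
  have hE0 : 0 < E := Real.exp_pos _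
  have hE4 : E ^ 4 = Real.exp (2 * Real.pi * R ^ 2) := by
    rw [hE, ← Real.exp_nat_mul]
    congr 1
    push_cast
    ring
  have hFE : ∀ w : ℂ, ‖w‖ = R → ‖F w‖ ≤ E := by
    intro w hw
    rw [hFn, hw]
    exact mul_le_of_le_one_right hE0.le ((norm_coherentTransform_le f _).trans hf)
  have hFm : ∀ w : ℂ, ‖w‖ = R → 2 / 3 * R ≤ (u * w).re → ‖F w‖ ≤ E * m := by
    intro w hw hre
    rw [hFn, hw]
    exact mul_le_mul_of_nonneg_left (h w hw hre) hE0.le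
  have hprod : ∀ {a b c d : ℝ}, 0 ≤ a → 0 ≤ b → 0 ≤ c → 0 ≤ d → a ≤ E → b ≤ E → c ≤ E →
      d ≤ E * m → a * b * c * d ≤ E ^ 4 * m := by
    intro a b c d ha hb hc hd ha' hb' hc' hd'
    calc a * b * c * d ≤ E * E * E * (E * m) := by gcongr
      _ = E ^ 4 * m := by ring
  -- Maximum principle for the product of the four quarter-turn rotations of `F`: for each w on the
  -- circle some rotation lies on the good arc, while the other three factors are at most `E`.
  have hG : ‖F 0 * F (Complex.I * 0) * F (-0) * F (-(Complex.I * 0))‖ ≤ E ^ 4 * m := by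
    refine Complex.norm_le_of_forall_mem_frontier_norm_le (U := Metric.ball (0 : ℂ) R)
      (f := fun w => F w * F (Complex.I * w) * F (-w) * F (-(Complex.I * w)))
      Metric.isBounded_ball ?_ ?_ (subset_closure (Metric.mem_ball_self hR))
    · refine Differentiable.diffContOnCl ?_
      exact ((hF.mul (hF.comp (by fun_prop))).mul (hF.comp (by fun_prop))).mul
        (hF.comp (by fun_prop))
    · intro w hw
      rw [frontier_ball _ hR.ne', mem_sphere_zero_iff_norm] at hw
      have n2 : ‖Complex.I * w‖ = R := by simp [hw]
      have n3 : ‖-w‖ = R := by simp [hw]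
      have n4 : ‖-(Complex.I * w)‖ = R := by simp [hw]
      simp only [norm_mul]
      have e1 := hFE w hw
      have e2 := hFE _ n2
      have e3 := hFE _ n3
      have e4 := hFE _ n4
      have hsq : (u * w).re ^ 2 + (u * w).im ^ 2 = R ^ 2 := by
        have : ‖u * w‖ = R := by rw [norm_mul, hu, hw, one_mul]
        rw [← this, ← Complex.normSq_eq_norm_sq, Complex.normSq_apply]
        ring
      have hI : (u * (Complex.I * w)).re = -(u * w).im := by
        rw [mul_left_comm]; simp
      rcases le_or_gt (2 / 3 * R) (u * w).re with c1 | c1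
      · have := hprod (norm_nonneg _) (norm_nonneg _) (norm_nonneg _) (norm_nonneg _)
          e2 e3 e4 (hFm w hw c1)
        linarith
      rcases le_or_gt (2 / 3 * R) (-(u * w).re) with c2 | c2
      · have := hprod (norm_nonneg _) (norm_nonneg _) (norm_nonneg _) (norm_nonneg _)
          e1 e2 e4 (hFm _ n3 (by rwa [mul_neg, Complex.neg_re]))
        linarith
      rcases le_or_gt (2 / 3 * R) (-(u * w).im) with c3 | c3
      · have := hprod (norm_nonneg _) (norm_nonneg _) (norm_nonneg _) (norm_nonneg _)
          e1 e3 e4 (hFm _ n2 (by rwa [hI]))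
        linarith
      rcases le_or_gt (2 / 3 * R) (u * w).im with c4 | c4
      · exact hprod (norm_nonneg _) (norm_nonneg _) (norm_nonneg _) (norm_nonneg _)
          e1 e2 e3 (hFm _ n4 (by rwa [mul_neg, Complex.neg_re, hI, neg_neg]))
      -- No rotation on the arc would force R² < 2 · (4/9) R², which is impossible.
      have b1 : (u * w).re ^ 2 < (2 / 3 * R) ^ 2 := sq_lt_sq' (by linarith) c1
      have b2 : (u * w).im ^ 2 < (2 / 3 * R) ^ 2 := sq_lt_sq' (by linarith) c4
      nlinarith [sq_nonneg R]
  rw [← hE4, ← hF0]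
  simp only [mul_zero, neg_zero, norm_mul] at hG
  calc ‖F 0‖ ^ 4 = ‖F 0‖ * ‖F 0‖ * ‖F 0‖ * ‖F 0‖ := by ring
    _ ≤ _ := hG

/-- The square concentric with `square a c` whose sides lie at distance `d` inside it. -/
def innerSquare (a : ℝ × ℝ) (c d : ℝ) : Set (ℝ × ℝ) :=
  Set.Icc (a.1 - (Real.sqrt c / 2 - d)) (a.1 + (Real.sqrt c / 2 - d)) ×ˢ
    Set.Icc (a.2 - (Real.sqrt c / 2 - d)) (a.2 + (Real.sqrt c / 2 - d))

/-! ### Decay of concentrated functions near the boundary of the square. -/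

/-- The direction u encodes the outward normal of a side that z is within d of, or beyond. A
displacement of 2d along it ends at least d ≥ 1 past that side. The imaginary part is reversed
because the analytic variable is x - iω. -/
theorem exists_direction_leaving_square {a z : ℝ × ℝ} {c d : ℝ} (hd : 1 ≤ d)
    (hz : z ∉ innerSquare a c d) :
    ∃ u : ℂ, ‖u‖ = 1 ∧ ∀ w : ℂ, 2 * d ≤ (u * w).re →
      Metric.closedBall ((z.1 + w.re, z.2 - w.im) : ℝ × ℝ) 1 ⊆ (square a c)ᶜ := by
  have hball : ∀ p q : ℝ × ℝ, q ∈ Metric.closedBall p 1 →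
      (p.1 - 1 ≤ q.1 ∧ q.1 ≤ p.1 + 1) ∧ (p.2 - 1 ≤ q.2 ∧ q.2 ≤ p.2 + 1) := by
    intro p q hq
    rw [Metric.mem_closedBall, Prod.dist_eq, max_le_iff, Real.dist_eq, Real.dist_eq, abs_le,
      abs_le] at hq
    refine ⟨⟨?_, ?_⟩, ?_, ?_⟩ <;> linarith [hq.1.1, hq.1.2, hq.2.1, hq.2.2]
  simp only [innerSquare, Set.mem_prod, Set.mem_Icc, not_and_or, not_le] at hz
  rcases hz with (h | h) | (h | h)
  · refine ⟨-1, by simp, fun w hw q hq hQ => ?_⟩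
    simp only [neg_mul, one_mul, Complex.neg_re] at hw
    have := (hball _ _ hq).1.2
    simp only [square, Set.mem_prod, Set.mem_Icc] at hQ this
    linarith [hQ.1.1]
  · refine ⟨1, by simp, fun w hw q hq hQ => ?_⟩
    simp only [one_mul] at hw
    have := (hball _ _ hq).1.1
    simp only [square, Set.mem_prod, Set.mem_Icc] at hQ this
    linarith [hQ.1.2]
  · refine ⟨-Complex.I, by simp, fun w hw q hq hQ => ?_⟩
    have hw' : 2 * d ≤ w.im := by simpa using hw
    have := (hball _ _ hq).2.2
    simp only [square, Set.mem_prod, Set.mem_Icc] at hQ this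
    linarith [hQ.2.1]
  · refine ⟨Complex.I, by simp, fun w hw q hq hQ => ?_⟩
    have hw' : 2 * d ≤ -w.im := by simpa using hw
    have := (hball _ _ hq).2.1
    simp only [square, Set.mem_prod, Set.mem_Icc] at hQ this
    linarith [hQ.2.2]

theorem measurableSet_square (a : ℝ × ℝ) (c : ℝ) : MeasurableSet (square a c) :=
  measurableSet_Icc.prod measurableSet_Icc

theorem setIntegral_compl_coherentTransform_sq {f : L2R} (hf : ‖f‖ = 1) {Q : Set (ℝ × ℝ)}
    (hQ : MeasurableSet Q) :
    ∫ p in Qᶜ, ‖coherentTransform f p‖ ^ 2 = 1 - ∫ p in Q, ‖coherentTransform f p‖ ^ 2 := by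
  have h := integral_add_compl hQ (integrable_coherentTransform_sq f)
  rw [integral_coherentTransform_sq, hf] at h
  linarith

/-- A function almost concentrated on the square has a small transform near its boundary. -/
theorem coherentTransform_sq_le_of_notMem_innerSquare {a z : ℝ × ℝ} {c d : ℝ} (hd : 1 ≤ d)
    {f : L2R} (hf : ‖f‖ = 1)
    (hs : 1 - 2 * Real.exp (-400 * d ^ 2) ≤ ∫ p in square a c, ‖coherentTransform f p‖ ^ 2)
    (hz : z ∉ innerSquare a c d) :
    ‖coherentTransform f z‖ ^ 2 ≤ Real.exp (-16 * d ^ 2) := by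
  obtain ⟨u, hu, hball⟩ := exists_direction_leaving_square hd hz
  have hout : ∫ p in (square a c)ᶜ, ‖coherentTransform f p‖ ^ 2 ≤ 2 * Real.exp (-400 * d ^ 2) := by
    rw [setIntegral_compl_coherentTransform_sq hf (measurableSet_square a c)]
    linarith
  -- `M` bounds the fourth power of the transform at centres of unit balls lying outside the square,
  -- and `m` is its fourth root.
  set M := 64 * Real.exp (2 * Real.pi) * (2 * Real.exp (-400 * d ^ 2)) with hM
  have hM0 : 0 ≤ M := by positivity
  set m := Real.sqrt (Real.sqrt M) with hm
  have hm4 : m ^ 4 = M := by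
    rw [show m ^ 4 = (m ^ 2) ^ 2 by ring, hm, Real.sq_sqrt (Real.sqrt_nonneg _),
      Real.sq_sqrt hM0]
  have hm0 : 0 ≤ m := Real.sqrt_nonneg _
  -- With R = 3d the arc condition 2R/3 ≤ Re(uw) is exactly the displacement 2d that leaves the
  -- square.
  have h4 := norm_coherentTransform_pow_four_le_of_arc hf.le z (R := 3 * d) (m := m)
    (by linarith) hu (fun w _ hw => ?_)
  · have h16 : (‖coherentTransform f z‖ ^ 2) ^ 8 ≤ Real.exp (-16 * d ^ 2) ^ 8 := by
      calc (‖coherentTransform f z‖ ^ 2) ^ 8 = (‖coherentTransform f z‖ ^ 4) ^ 4 := by ring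
        _ ≤ (Real.exp (2 * Real.pi * (3 * d) ^ 2) * m) ^ 4 := by gcongr
        _ = Real.exp (2 * Real.pi * (3 * d) ^ 2) ^ 4 * M := by rw [mul_pow, hm4]
        _ = 128 * Real.exp (72 * Real.pi * d ^ 2 + 2 * Real.pi - 400 * d ^ 2) := by
          rw [hM, ← Real.exp_nat_mul, sub_eq_add_neg, Real.exp_add, Real.exp_add, ← neg_mul]
          push_cast
          ring_nf
        _ ≤ Real.exp 7 * Real.exp (72 * Real.pi * d ^ 2 + 2 * Real.pi - 400 * d ^ 2) := by
          gcongr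
          have : (2 : ℝ) ≤ Real.exp 1 := by linarith [Real.add_one_le_exp (1 : ℝ)]
          calc (128 : ℝ) = 2 ^ 7 := by norm_num
            _ ≤ Real.exp 1 ^ 7 := by gcongr
            _ = Real.exp 7 := by rw [← Real.exp_nat_mul]; norm_num
        _ ≤ Real.exp (-16 * d ^ 2) ^ 8 := by
          rw [← Real.exp_add, ← Real.exp_nat_mul, Real.exp_le_exp]
          have h1 : 1 ≤ d ^ 2 := one_le_pow₀ hd
          push_cast
          -- This fixes the constant 400: since d ≥ 1, 7 + 2π + 72π d² - 400 d² ≤ -128 d².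
          nlinarith [mul_le_mul_of_nonneg_right Real.pi_lt_d2.le (sq_nonneg d), Real.pi_lt_d2]
    exact le_of_pow_le_pow_left₀ (by norm_num) (Real.exp_pos _).le h16
  · have h1 := norm_coherentTransform_pow_four_le hf.le (z.1 + w.re, z.2 - w.im)
    have h2 := setIntegral_mono_set (integrable_coherentTransform_sq f).integrableOn
      (Filter.Eventually.of_forall fun p => sq_nonneg ‖coherentTransform f p‖)
      (hball w (by linarith)).eventuallyLE (μ := volume)
    refine le_of_pow_le_pow_left₀ (n := 4) (by norm_num) hm0 ?_
    rw [hm4]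
    exact h1.trans (mul_le_mul_of_nonneg_left (h2.trans hout) (by positivity))

/-! ### Counting concentrated functions, and the conclusion. -/

theorem volume_real_square {a : ℝ × ℝ} {c : ℝ} (hc : 0 ≤ c) : volume.real (square a c) = c := by
  rw [square, Measure.volume_eq_prod, measureReal_prod_prod, Real.volume_real_Icc,
    Real.volume_real_Icc]
  have h : ∀ x : ℝ, x + Real.sqrt c / 2 - (x - Real.sqrt c / 2) = Real.sqrt c := fun x => by ring
  rw [h, h, max_eq_left (Real.sqrt_nonneg c), Real.mul_self_sqrt hc]

theorem volume_real_innerSquare (a : ℝ × ℝ) (c d : ℝ) :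
    volume.real (innerSquare a c d) = max (Real.sqrt c - 2 * d) 0 ^ 2 := by
  rw [innerSquare, Measure.volume_eq_prod, measureReal_prod_prod, Real.volume_real_Icc,
    Real.volume_real_Icc]
  have h : ∀ x : ℝ, x + (Real.sqrt c / 2 - d) - (x - (Real.sqrt c / 2 - d))
    = Real.sqrt c - 2 * d := fun x => by ring
  rw [h, h, sq]

/-- The number of orthonormal functions almost concentrated on a square is, up to small errors,
at most the area of a smaller concentric square. -/
theorem card_mul_le_of_concentrated {a : ℝ × ℝ} {c d : ℝ} (hc : 0 ≤ c) (hd : 1 ≤ d) {n : ℕ}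
    {v : Fin n → L2R} (hv : Orthonormal ℂ v)
    (hs : ∀ i, 1 - 2 * Real.exp (-400 * d ^ 2)
      ≤ ∫ p in square a c, ‖coherentTransform (v i) p‖ ^ 2) :
    n * (1 - 2 * Real.exp (-400 * d ^ 2))
      ≤ max (Real.sqrt c - 2 * d) 0 ^ 2 + n * Real.exp (-16 * d ^ 2) * c := by
  set Q := square a c with hQ
  have hQfin : volume Q ≠ ⊤ := (volume_square_lt_top a c).ne
  have hIm : MeasurableSet (innerSquare a c d) := measurableSet_Icc.prod measurableSet_Icc
  have hIfin : volume (innerSquare a c d) ≠ ⊤ :=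
    (isCompact_Icc.prod isCompact_Icc).measure_lt_top.ne
  -- Bessel on the inner square, termwise decay off it.
  have hpt : ∀ p, ∑ i, ‖coherentTransform (v i) p‖ ^ 2
      ≤ (innerSquare a c d).indicator (fun _ => (1 : ℝ)) p + n * Real.exp (-16 * d ^ 2) := by
    intro p
    by_cases hp : p ∈ innerSquare a c d
    · rw [Set.indicator_of_mem hp]
      have := sum_coherentTransform_sq_le hv p
      have : 0 ≤ n * Real.exp (-16 * d ^ 2) := by positivity
      linarith
    · rw [Set.indicator_of_notMem hp, zero_add]
      calc _ ≤ ∑ _i : Fin n, Real.exp (-16 * d ^ 2) := Finset.sum_le_sum fun i _ =>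
            coherentTransform_sq_le_of_notMem_innerSquare hd (hv.1 i) (hs i) hp
        _ = _ := by simp
  have hint : ∀ i, IntegrableOn (fun p => ‖coherentTransform (v i) p‖ ^ 2) Q := fun i =>
    (integrable_coherentTransform_sq (v i)).integrableOn
  have hind : Integrable ((innerSquare a c d).indicator fun _ => (1 : ℝ)) :=
    (integrable_indicator_iff hIm).2 (integrableOn_const hIfin)
  have hconst : IntegrableOn (fun _ : ℝ × ℝ => n * Real.exp (-16 * d ^ 2)) Q :=
    integrableOn_const hQfin
  calc n * (1 - 2 * Real.exp (-400 * d ^ 2))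
      = ∑ _i : Fin n, (1 - 2 * Real.exp (-400 * d ^ 2)) := by
        rw [Finset.sum_const, Finset.card_univ, Fintype.card_fin, nsmul_eq_mul]
    _ ≤ ∑ i, ∫ p in Q, ‖coherentTransform (v i) p‖ ^ 2 := Finset.sum_le_sum fun i _ => hs i
    _ = ∫ p in Q, ∑ i, ‖coherentTransform (v i) p‖ ^ 2 :=
        (integral_finsetSum _ fun i _ => hint i).symm
    _ ≤ ∫ p in Q, ((innerSquare a c d).indicator (fun _ => (1 : ℝ)) p
          + n * Real.exp (-16 * d ^ 2)) :=
        integral_mono (integrable_finsetSum _ fun i _ => hint i)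
          (hind.integrableOn.add hconst) hpt
    _ = (∫ p in Q, (innerSquare a c d).indicator (fun _ => (1 : ℝ)) p)
          + n * Real.exp (-16 * d ^ 2) * c := by
        rw [integral_add hind.integrableOn hconst, setIntegral_const, hQ, volume_real_square hc,
          smul_eq_mul, mul_comm c]
    _ ≤ (∫ p, (innerSquare a c d).indicator (fun _ => (1 : ℝ)) p)
          + n * Real.exp (-16 * d ^ 2) * c := by
        refine add_le_add_left ?_ _
        exact setIntegral_le_integral hind (Filter.Eventually.of_forall fun p =>
          Set.indicator_nonneg (fun _ _ => zero_le_one) p)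
    _ = _ := by
        rw [integral_indicator hIm, setIntegral_const, volume_real_innerSquare, smul_eq_mul,
          mul_one]

/-- Factor c - n = (√c - √n)(√c + √n) ≤ 2√c (√c - √n), compare with √c √(log c) < c - n, and square.
-/
theorem log_le_of_lt_sub_sqrt {c : ℝ} (hc : 1 ≤ c) {n : ℕ}
    (hn : (n : ℝ) < c - Real.sqrt (c * Real.log c)) :
    0 ≤ Real.sqrt c - Real.sqrt n ∧ Real.log c ≤ 4 * (Real.sqrt c - Real.sqrt n) ^ 2 := by
  have hc0 : 0 < c := by linarith
  have hnc : (n : ℝ) ≤ c := by linarith [Real.sqrt_nonneg (c * Real.log c)]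
  have hle : Real.sqrt n ≤ Real.sqrt c := Real.sqrt_le_sqrt hnc
  have h1 : Real.sqrt c ^ 2 = c := Real.sq_sqrt hc0.le
  have h2 : Real.sqrt (n : ℝ) ^ 2 = n := Real.sq_sqrt (Nat.cast_nonneg n)
  have hsc : 0 < Real.sqrt c := Real.sqrt_pos.2 hc0
  refine ⟨by linarith, ?_⟩
  rw [Real.sqrt_mul hc0.le] at hn
  have h3 : Real.sqrt c * Real.sqrt (Real.log c)
      ≤ Real.sqrt c * (2 * (Real.sqrt c - Real.sqrt n)) := by
    nlinarith [Real.sqrt_nonneg (n : ℝ)]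
  have h4 := le_of_mul_le_mul_left h3 hsc
  have h5 := pow_le_pow_left₀ (Real.sqrt_nonneg _) h4 2
  rw [Real.sq_sqrt (Real.log_nonneg hc)] at h5
  linarith

theorem theorem1p8 :
    ∃ c₀ κ : ℝ, 0 < c₀ ∧ 0 < κ ∧
      ∀ (a : ℝ × ℝ) (c : ℝ), c₀ < c → ∀ n : ℕ, 1 ≤ n →
        (n : ℝ) < c - Real.sqrt (c * Real.log c) →
        coherentEigenvalue a c n
          < 1 - Real.exp (-κ * (Real.sqrt c - Real.sqrt (n : ℝ)) ^ 2) := by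
  -- The threshold e⁴ makes log c > 4, which forces d > 1, as the boundary estimate requires.
  refine ⟨Real.exp 4, 400, Real.exp_pos _, by norm_num, fun a c hc n hn1 hn => ?_⟩
  have hc5 : 5 < c := by linarith [Real.add_one_le_exp (4 : ℝ)]
  have hc0 : 0 < c := by linarith
  obtain ⟨hd0, hlog⟩ := log_le_of_lt_sub_sqrt (by linarith) hn
  set d := Real.sqrt c - Real.sqrt (n : ℝ) with hd
  have hlog4 : 4 < Real.log c := (Real.lt_log_iff_exp_lt hc0).2 hc
  have hd2 : 1 < d ^ 2 := by linarith
  have hd1 : 1 ≤ d := by nlinarith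
  have hcexp : c ≤ Real.exp (4 * d ^ 2) := by
    rw [← Real.exp_log hc0]
    exact Real.exp_le_exp.2 hlog
  have hcinv : Real.exp (-16 * d ^ 2) * c ^ 4 ≤ 1 := by
    calc _ ≤ Real.exp (-16 * d ^ 2) * Real.exp (4 * d ^ 2) ^ 4 := by gcongr
      _ = 1 := by
        rw [← Real.exp_nat_mul, ← Real.exp_add, Real.exp_eq_one_iff]
        push_cast
        ring
  have hsmall : Real.exp (-400 * d ^ 2) ≤ Real.exp (-16 * d ^ 2) :=
    Real.exp_le_exp.2 (by nlinarith)
  have he1 : Real.exp (-400 * d ^ 2) < 1 := Real.exp_lt_one_iff.2 (by nlinarith)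
  by_contra! hcon
  rw [coherentEigenvalue, nthEigenvalue] at hcon
  set S := {t : ℝ | 0 < t ∧ ∃ v : Fin n → L2R, Orthonormal ℂ v ∧
    ∀ i, ∃ s : ℝ, t ≤ s ∧
      localizationOp (square a c) (volume_square_lt_top a c) (v i) = (s : ℂ) • v i} with hS
  -- An empty set would have supremum 0 by convention, less than 1 - exp(-400 d²).
  have hne : S.Nonempty := by
    by_contra hemp
    rw [Set.not_nonempty_iff_eq_empty.1 hemp, Real.sSup_empty] at hcon
    linarith
  -- The factor 2 leaves room below the supremum, so its attainment is not needed.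
  obtain ⟨t, ⟨-, v, hv, hvs⟩, ht⟩ := exists_lt_of_lt_csSup hne
    (show 1 - 2 * Real.exp (-400 * d ^ 2) < sSup S by
      linarith [Real.exp_pos (-400 * d ^ 2)])
  have hs : ∀ i, 1 - 2 * Real.exp (-400 * d ^ 2)
      ≤ ∫ p in square a c, ‖coherentTransform (v i) p‖ ^ 2 := by
    intro i
    obtain ⟨s, hts, hsi⟩ := hvs i
    rw [setIntegral_coherentTransform_sq_of_eigenvector (hv.1 i) hsi]
    linarith
  have key := card_mul_le_of_concentrated hc0.le hd1 hv hs
  have hnc : (n : ℝ) ≤ c := by linarith [Real.sqrt_nonneg (c * Real.log c)]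
  have hn1' : (1 : ℝ) ≤ n := by exact_mod_cast hn1
  set τ := Real.exp (-16 * d ^ 2) with hτ
  have hτ0 : 0 < τ := Real.exp_pos _
  have herr : n * (2 * Real.exp (-400 * d ^ 2)) + n * τ * c ≤ 1 / 2 := by
    have h1 : n * (2 * Real.exp (-400 * d ^ 2)) ≤ c * (2 * τ) := by gcongr
    have h2 : n * τ * c ≤ c * τ * c := by gcongr
    have h3 : c * (2 * τ) + c * τ * c ≤ τ * c ^ 4 / 2 := by
      have : 4 + 2 * c ≤ c ^ 3 := by nlinarith [mul_pos hc0 hc0]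
      nlinarith [mul_pos hτ0 hc0]
    linarith
  have hsn : Real.sqrt c - d = Real.sqrt n := by rw [hd]; ring
  have hnsq : (Real.sqrt c - d) ^ 2 = n := by rw [hsn, Real.sq_sqrt (Nat.cast_nonneg n)]
  -- If the inner square has no area, n ≤ 1/2. Otherwise d ≤ √n and (√n - d)² ≤ n - d² < n - 1, more
  -- than the error 1/2 can make up.
  rcases le_total (Real.sqrt c - 2 * d) 0 with h0 | h0
  · rw [max_eq_right h0] at key
    linarith
  · rw [max_eq_left h0] at key
    nlinarith
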